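/- Let $m\ge 1$ and let $V\subset\mathbb R^m$ be a closed (compact) convex body with nonempty interior, centrally symmetric with respect to the origin, that satisfies the $\Pi$-condition: for every $t\in V\setminus\{0\}$ the set $\{y\in\mathbb R^m: |y_j|\le |t_j|,\ 1\le j\le m\}$ is contained in $V$. Let $a\ge 0$, $p\in[1,\infty)$, $\lambda_j\ge 0$ for $1\le j\le m$, $Q^m:=[-1,1]^m$, and $W(x):=\prod_{j=1}^m(1-x_j^2)^{\lambda_j-1/2}$. Let $\mathcal P_{aV}$ be the space of polynomials $P(x)=\sum_{k\in aV\cap\mathbb Z_+^m}c_kx^k$ with complex coefficients, and put $$\mathcal N:=\sup_{h\in\mathcal P_{aV}\setminus\{0\}}\frac{\|h\|_{L_\infty(Q^m)}}{\|h\|_{L_{p,W}(Q^m)}},\qquad \|h\|_{L_{p,W}(Q^m)}:=\Big(\int_{Q^m}|h(x)|^pW(x)\,dx\Big)^{1/p}.$$ Then for every vertex $x_0$ of $Q^m$ (that is, $|x_{0,j}|=1$ for $1\le j\le m$) there exists an extremal polynomial $P^*\in\mathcal P_{aV}\setminus\{0\}$, that is, $$\mathcal N=\frac{\|P^*\|_{L_\infty(Q^m)}}{\|P^*\|_{L_{p,W}(Q^m)}},$$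 such that $\|P^*\|_{L_\infty(Q^m)}=|P^*(x_0)|$. -/

import Mathlib

open MeasureTheory
open scoped ENNReal Pointwise

noncomputable section

namespace CubeNikolskii

/-- A centrally symmetric (with respect to the origin) closed convex body in `ℝ^m`: a compact
convex set with non-empty interior such that `-V = V`. -/
structure IsSymmConvexBody {m : ℕ} (V : Set (Fin m → ℝ)) : Prop where
  convex : Convex ℝ V
  isCompact : IsCompact V
  interior_nonempty : (interior V).Nonempty
  neg_mem : ∀ t ∈ V, -t ∈ V

/-- The parallelepiped `Π^m(σ) = {t : |t_j| ≤ |σ_j|, 1 ≤ j ≤ m}`. -/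
def parallelepiped {m : ℕ} (σ : Fin m → ℝ) : Set (Fin m → ℝ) :=
  {t | ∀ j, |t j| ≤ |σ j|}

/-- The parallelepiped condition (Π-condition) on `V`. -/
def PiCondition {m : ℕ} (V : Set (Fin m → ℝ)) : Prop :=
  ∀ t ∈ V, t ≠ 0 → parallelepiped t ⊆ V

/-- The cube `Q^m = [-1, 1]^m`. -/
def cube (m : ℕ) : Set (Fin m → ℝ) :=
  {x | ∀ j, |x j| ≤ 1}

/-- The set of vertices of the cube `Q^m`. -/
def cubeVertices (m : ℕ) : Set (Fin m → ℝ) :=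
  {x | ∀ j, |x j| = 1}

/-- `𝒫_Ω`: the polynomials `∑_{k ∈ Ω ∩ ℤ_+^m} c_k x^k` with complex coefficients. -/
def polyClass {m : ℕ} (Ω : Set (Fin m → ℝ)) : Submodule ℂ (MvPolynomial (Fin m) ℂ) :=
  MvPolynomial.restrictSupport ℂ {k : Fin m →₀ ℕ | (fun j => (k j : ℝ)) ∈ Ω}

/-- The function `ℝ^m → ℂ` given by a polynomial with complex coefficients. -/
def polyFun {m : ℕ} (P : MvPolynomial (Fin m) ℂ) (x : Fin m → ℝ) : ℂ :=
  MvPolynomial.eval (fun j => (x j : ℂ)) P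

/-- The weighted norm `‖F‖_{L_{p,W}(Ω)} = (∫_Ω |F(x)|^p W(x) dx)^{1/p}`, `0 < p < ∞`, for a weight
`W` with values in `[0, ∞]`. -/
def weightedLpNorm {m : ℕ} (p : ℝ) (W : (Fin m → ℝ) → ℝ≥0∞) (Ω : Set (Fin m → ℝ))
    (F : (Fin m → ℝ) → ℂ) : ℝ≥0∞ :=
  eLpNorm F (ENNReal.ofReal p) ((volume.restrict Ω).withDensity W)

/-- The norm `‖F‖_{L_∞(Ω)} = ess sup_{x ∈ Ω} |F(x)|` (with respect to Lebesgue measure). -/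
def supNorm {m : ℕ} (Ω : Set (Fin m → ℝ)) (F : (Fin m → ℝ) → ℂ) : ℝ≥0∞ :=
  eLpNorm F ∞ (volume.restrict Ω)

/-- The sharp constant
`𝒩(B, L_{p,W}(Ω)) = sup_{h ∈ B ∖ {0}} ‖h‖_{L_∞(Ω)} / ‖h‖_{L_{p,W}(Ω)}`
for a space `B` of polynomials. -/
def sharpConst {m : ℕ} (B : Submodule ℂ (MvPolynomial (Fin m) ℂ)) (p : ℝ)
    (W : (Fin m → ℝ) → ℝ≥0∞) (Ω : Set (Fin m → ℝ)) : ℝ≥0∞ :=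
  ⨆ h ∈ {h : MvPolynomial (Fin m) ℂ | h ∈ B ∧ h ≠ 0},
    supNorm Ω (polyFun h) / weightedLpNorm p W Ω (polyFun h)

/-- `P` is an extremal polynomial for `𝒩(B, L_{p,W}(Ω))`. -/
def IsExtremalPolynomial {m : ℕ} (B : Submodule ℂ (MvPolynomial (Fin m) ℂ)) (p : ℝ)
    (W : (Fin m → ℝ) → ℝ≥0∞) (Ω : Set (Fin m → ℝ)) (P : MvPolynomial (Fin m) ℂ) : Prop :=
  P ∈ B ∧ P ≠ 0 ∧
    sharpConst B p W Ω = supNorm Ω (polyFun P) / weightedLpNorm p W Ω (polyFun P)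

/-- The Gegenbauer-type weight `∏_j (1 - x_j^2)^{λ_j - 1/2}` on `Q^m`, with values in `[0, ∞]`. -/
def gegenbauerWeight {m : ℕ} (lam : Fin m → ℝ) (x : Fin m → ℝ) : ℝ≥0∞ :=
  ∏ j, ENNReal.ofReal (1 - x j ^ 2) ^ (lam j - 1 / 2)

end CubeNikolskii

end

/-! The proof moves a maximum point to a vertex one coordinate at a time by generalized (Gegenbauer)
translation. In the `j`-th variable, replace `h` by `Q(x) = ∫ h(…, s x_j + u r √(1 - x_j²), …)
dρ(u)`, where `s² + r² = 1` and `ρ` is a symmetric probability measure on `[-1, 1]` depending on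
`λ_j`.

Three facts make this work. Odd moments of `ρ` vanish, so the square root leaves only polynomial
terms of no larger degree in `x_j`; the Π-condition makes the exponent set a lower set, so `Q` stays
in the class (`exists_polyFun_eq_integral`). The translation preserves integrals against `(1 -
t²)^{λ_j - 1/2}` (`exists_isTranslationMeasure`), so by Jensen it contracts the weighted norm
(`weightedLpNorm_translate_le`). At `x_j = ε = ±1` the root vanishes and `Q` takes the value of `h`
at `x_j = sε`.

If an extremal `P` attains its maximum modulus at `x`, the choice `s = x_j ε` carries that value to
the point with `j`-th coordinate `ε`. The norm does not grow, so extremality forces `Q` to be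
extremal with the same sup norm (`IsExtremalPolynomial.exists_update`). A first extremal exists by
finite-dimensional compactness (`exists_isExtremalPolynomial`). -/

namespace CubeNikolskii

/-! ### One-dimensional Jacobi densities -/

/-- The one-dimensional Jacobi density `(1 - t^2)^α` with values in `[0, ∞]`. -/
noncomputable def jacobiDensity (α t : ℝ) : ℝ≥0∞ := ENNReal.ofReal (1 - t ^ 2) ^ α

@[fun_prop]
lemma measurable_jacobiDensity (α : ℝ) : Measurable (jacobiDensity α) := by
  unfold jacobiDensity; fun_prop

lemma lintegral_ofReal_rpow_lt_top {α : ℝ} (hα : -1 < α) :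
    ∫⁻ t in Set.Icc (0 : ℝ) 2, ENNReal.ofReal t ^ α < ∞ := by
  have h := (intervalIntegral.intervalIntegrable_rpow' (a := 0) (b := 2) hα)
  rw [intervalIntegrable_iff_integrableOn_Ioc_of_le (by norm_num)] at h
  have h2 := h.lintegral_lt_top
  rw [setLIntegral_congr Ioc_ae_eq_Icc.symm]
  refine lt_of_le_of_lt (le_of_eq ?_) h2
  refine setLIntegral_congr_fun measurableSet_Ioc fun t ht => ?_
  exact ENNReal.ofReal_rpow_of_pos ht.1

lemma ofReal_rpow_le_ofReal_rpow_of_nonpos {α x y : ℝ} (hα : α ≤ 0) (h : x ≤ y) :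
    ENNReal.ofReal y ^ α ≤ ENNReal.ofReal x ^ α := by
  rw [← neg_neg α, ENNReal.rpow_neg, ENNReal.rpow_neg _ (-α)]
  exact ENNReal.inv_le_inv.2
    (ENNReal.rpow_le_rpow (ENNReal.ofReal_le_ofReal h) (neg_nonneg.2 hα))

lemma lintegral_jacobiDensity_lt_top {α : ℝ} (hα : -1 < α) :
    ∫⁻ t in Set.Icc (-1 : ℝ) 1, jacobiDensity α t < ∞ := by
  have hvol : ∫⁻ _ in Set.Icc (-1 : ℝ) 1, (1 : ℝ≥0∞) < ∞ := by
    simp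
  rcases le_or_gt 0 α with h0 | h0
  · refine lt_of_le_of_lt (lintegral_mono fun t => ?_) hvol
    refine ENNReal.rpow_le_one ?_ h0
    rw [ENNReal.ofReal_le_one]
    nlinarith [sq_nonneg t]
  -- Of the two factors of `(1 + t)(1 - t)`, one is at least `1`, so each endpoint singularity is
  -- controlled by the other factor alone.
  · have key : ∀ t ∈ Set.Icc (-1 : ℝ) 1,
        jacobiDensity α t ≤ ENNReal.ofReal (1 + t) ^ α + ENNReal.ofReal (1 - t) ^ α := by
      intro t ht
      rcases le_total t 0 with h | h
      · refine le_add_right (ofReal_rpow_le_ofReal_rpow_of_nonpos h0.le ?_)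
        nlinarith [ht.1]
      · refine le_add_left (ofReal_rpow_le_ofReal_rpow_of_nonpos h0.le ?_)
        nlinarith [ht.2]
    have h1 : ∫⁻ t in Set.Icc (-1 : ℝ) 1, ENNReal.ofReal (1 + t) ^ α =
        ∫⁻ t in Set.Icc (0 : ℝ) 2, ENNReal.ofReal t ^ α := by
      have := (measurePreserving_add_left (volume : Measure ℝ) 1).setLIntegral_comp_preimage
        (measurableSet_Icc (a := (0 : ℝ)) (b := 2)) (f := fun t => ENNReal.ofReal t ^ α)
        (by fun_prop)
      rw [← this]
      congr 2
      ext t; simp only [Set.mem_Icc, Set.mem_preimage]; constructor <;> rintro ⟨_, _⟩ <;>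
        constructor <;> linarith
    have h2 : ∫⁻ t in Set.Icc (-1 : ℝ) 1, ENNReal.ofReal (1 - t) ^ α =
        ∫⁻ t in Set.Icc (-1 : ℝ) 1, ENNReal.ofReal (1 + t) ^ α := by
      have := (Measure.measurePreserving_neg (volume : Measure ℝ)).setLIntegral_comp_preimage
        (measurableSet_Icc (a := (-1 : ℝ)) (b := 1)) (f := fun t => ENNReal.ofReal (1 + t) ^ α)
        (by fun_prop)
      rw [← this]
      simp [sub_eq_add_neg]
    refine lt_of_le_of_lt (setLIntegral_mono' measurableSet_Icc key) ?_
    rw [lintegral_add_left (by fun_prop), h2, h1]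
    exact ENNReal.add_lt_top.2
      ⟨lintegral_ofReal_rpow_lt_top hα, lintegral_ofReal_rpow_lt_top hα⟩

lemma jacobiDensity_pos {α t : ℝ} (ht : t ∈ Set.Ioo (-1 : ℝ) 1) : 0 < jacobiDensity α t := by
  refine ENNReal.rpow_pos (ENNReal.ofReal_pos.2 ?_) ENNReal.ofReal_ne_top
  nlinarith [ht.1, ht.2]

lemma lintegral_jacobiDensity_ne_zero (α : ℝ) :
    ∫⁻ t in Set.Icc (-1 : ℝ) 1, jacobiDensity α t ≠ 0 := by
  rw [← setLIntegral_congr Ioo_ae_eq_Icc, ← pos_iff_ne_zero,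
    setLIntegral_pos_iff (measurable_jacobiDensity α)]
  have : Set.Ioo (-1 : ℝ) 1 ⊆ Function.support (jacobiDensity α) ∩ Set.Ioo (-1) 1 :=
    fun t ht => ⟨(jacobiDensity_pos ht).ne', ht⟩
  exact lt_of_lt_of_le (by simp) (measure_mono this)

/-! ### Rotation-invariant weights on the disc -/

/-- The weight `(1 - |z|^2)^α` on the open unit disc. -/
noncomputable def discWeight (α : ℝ) (z : ℂ) : ℝ≥0∞ :=
  Set.indicator {z : ℂ | Complex.normSq z < 1}
    (fun z => ENNReal.ofReal (1 - Complex.normSq z) ^ α) z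

lemma measurable_discWeight (α : ℝ) : Measurable (discWeight α) := by
  have h : Measurable Complex.normSq := Complex.continuous_normSq.measurable
  exact Measurable.indicator (by fun_prop) (measurableSet_lt h measurable_const)

lemma lintegral_mul_left_scale {q : ℝ} (hq : 0 < q) (F : ℝ → ℝ≥0∞) :
    ∫⁻ v, F v = ∫⁻ u, ENNReal.ofReal q * F (q * u) := by
  have := lintegral_image_eq_lintegral_abs_deriv_mul (s := Set.univ) (f := fun u => q * u)
    (f' := fun _ => q) MeasurableSet.univ
    (fun x _ => by simpa using (hasDerivAt_id x).const_mul q)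
    (fun x _ y _ h => by simpa [hq.ne'] using h) F
  rw [Set.image_univ, (mul_left_surjective₀ hq.ne').range_eq] at this
  simpa [abs_of_pos hq] using this

/-- Substitute `v = u √(1 - t²)`: then `1 - t² - v² = (1 - t²)(1 - u²)`, and the Jacobian supplies
the extra exponent in `λ - 1/2 = 1/2 + (λ - 1)`. -/
lemma jacobiDensity_mul_lintegral_eq {lam t : ℝ} (ht : t ∈ Set.Ioo (-1 : ℝ) 1)
    (s r : ℝ) (g : ℝ → ℝ≥0∞) :
    jacobiDensity (lam - 1 / 2) t * ∫⁻ u in Set.Icc (-1 : ℝ) 1, jacobiDensity (lam - 1) u *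
        g (s * t + u * (r * √(1 - t ^ 2))) =
      ∫⁻ v : ℝ, discWeight (lam - 1) ⟨t, v⟩ * g (s * t + r * v) := by
  have h1 : 0 < 1 - t ^ 2 := by nlinarith [ht.1, ht.2]
  set q := √(1 - t ^ 2) with hq
  have hq0 : 0 < q := Real.sqrt_pos.2 h1
  have hq2 : q ^ 2 = 1 - t ^ 2 := Real.sq_sqrt h1.le
  rw [lintegral_mul_left_scale hq0, ← setLIntegral_congr Ioo_ae_eq_Icc,
    ← lintegral_indicator measurableSet_Ioo, ← lintegral_const_mul']
  swap
  · exact ENNReal.rpow_ne_top_of_ne_zero (ENNReal.ofReal_pos.2 h1).ne' ENNReal.ofReal_ne_top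
  refine lintegral_congr fun u => ?_
  have hn : Complex.normSq ⟨t, q * u⟩ = t ^ 2 + q ^ 2 * u ^ 2 := by
    simp [Complex.normSq_mk]; ring
  have hmem : u ∈ Set.Ioo (-1 : ℝ) 1 ↔
      (⟨t, q * u⟩ : ℂ) ∈ {z : ℂ | Complex.normSq z < 1} := by
    rw [Set.mem_ofPred_eq, hn, Set.mem_Ioo, ← abs_lt, ← sq_lt_one_iff_abs_lt_one]
    constructor
    · intro h; nlinarith
    · intro h; by_contra hc; nlinarith
  unfold discWeight
  by_cases hu : u ∈ Set.Ioo (-1 : ℝ) 1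
  · rw [Set.indicator_of_mem hu, Set.indicator_of_mem (hmem.1 hu), hn]
    have e1 : 1 - (t ^ 2 + q ^ 2 * u ^ 2) = (1 - t ^ 2) * (1 - u ^ 2) := by rw [hq2]; ring
    have e2 : ENNReal.ofReal q = ENNReal.ofReal (1 - t ^ 2) ^ (1 / 2 : ℝ) := by
      rw [ENNReal.ofReal_rpow_of_pos h1, hq, Real.sqrt_eq_rpow]
    have hu1 : 0 < 1 - u ^ 2 := by nlinarith [hu.1, hu.2]
    rw [e1, ENNReal.ofReal_mul h1.le, ENNReal.mul_rpow_of_ne_top ENNReal.ofReal_ne_top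
      ENNReal.ofReal_ne_top, e2, jacobiDensity, jacobiDensity,
      show lam - 1 / 2 = 1 / 2 + (lam - 1) by ring,
      ENNReal.rpow_add _ _ (ENNReal.ofReal_pos.2 h1).ne' ENNReal.ofReal_ne_top]
    rw [show s * t + r * (q * u) = s * t + u * (r * q) by ring]
    ring
  · rw [Set.indicator_of_notMem hu, Set.indicator_of_notMem (fun h => hu (hmem.2 h))]
    simp

lemma lintegral_complex_eq (F : ℂ → ℝ≥0∞) (hF : Measurable F) :
    ∫⁻ z, F z = ∫⁻ t : ℝ, ∫⁻ v : ℝ, F ⟨t, v⟩ := by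
  rw [← (Complex.volume_preserving_equiv_real_prod.symm).lintegral_comp hF]
  exact lintegral_prod _ (hF.comp Complex.measurableEquivRealProd.symm.measurable).aemeasurable

lemma lintegral_jacobiDensity_mul_lintegral_eq (lam s r : ℝ) (g : ℝ → ℝ≥0∞)
    (hg : Measurable g) :
    ∫⁻ t in Set.Icc (-1 : ℝ) 1, jacobiDensity (lam - 1 / 2) t *
        ∫⁻ u in Set.Icc (-1 : ℝ) 1, jacobiDensity (lam - 1) u *
          g (s * t + u * (r * √(1 - t ^ 2))) =
      ∫⁻ z : ℂ, discWeight (lam - 1) z * g (s * z.re + r * z.im) := by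
  have hm := measurable_discWeight (lam - 1)
  have hre : Measurable Complex.re := Complex.measurable_re
  have him : Measurable Complex.im := Complex.measurable_im
  rw [lintegral_complex_eq _ (by fun_prop), ← setLIntegral_congr Ioo_ae_eq_Icc,
    setLIntegral_congr_fun measurableSet_Ioo
      (fun t ht => jacobiDensity_mul_lintegral_eq ht s r g)]
  rw [← lintegral_indicator measurableSet_Ioo]
  refine lintegral_congr fun t => ?_
  by_cases ht : t ∈ Set.Ioo (-1 : ℝ) 1
  · rw [Set.indicator_of_mem ht]
  · rw [Set.indicator_of_notMem ht]
    symm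
    refine (lintegral_congr fun v => ?_).trans lintegral_zero
    have : (⟨t, v⟩ : ℂ) ∉ {z : ℂ | Complex.normSq z < 1} := by
      simp only [Set.mem_ofPred_eq, Complex.normSq_mk, not_lt]
      rw [Set.mem_Ioo, ← abs_lt, ← sq_lt_one_iff_abs_lt_one] at ht
      nlinarith [sq_nonneg v]
    simp [discWeight, Set.indicator_of_notMem this]

/-- The form `s Re z + r Im z` is the real part of `(s - ir) z`, and multiplication by a unit
complex number preserves both area and the radial weight. -/
lemma lintegral_discWeight_rotate (α : ℝ) {s r : ℝ} (hsr : s ^ 2 + r ^ 2 = 1) (g : ℝ → ℝ≥0∞)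
    (hg : Measurable g) :
    ∫⁻ z : ℂ, discWeight α z * g (s * z.re + r * z.im) =
      ∫⁻ z : ℂ, discWeight α z * g z.re := by
  have hm := measurable_discWeight α
  have hre : Measurable Complex.re := Complex.measurable_re
  have hn : ‖(⟨s, -r⟩ : ℂ)‖ = 1 := by
    rw [← sq_eq_sq₀ (norm_nonneg _) zero_le_one, ← Complex.normSq_eq_norm_sq, Complex.normSq_mk]
    nlinarith
  let c : Circle := ⟨⟨s, -r⟩, by simpa [Submonoid.unitSphere] using hn⟩
  have hmp := (rotation c).measurePreserving
  rw [← hmp.lintegral_comp (f := fun z => discWeight α z * g z.re) (by fun_prop)]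
  refine lintegral_congr fun z => ?_
  have h1 : Complex.normSq (rotation c z) = Complex.normSq z := by
    simp only [Complex.normSq_eq_norm_sq, LinearIsometryEquiv.norm_map]
  have h2 : (rotation c z).re = s * z.re + r * z.im := by
    rw [rotation_apply, Complex.mul_re]
    simp only [c]
    ring
  have h3 : discWeight α (rotation c z) = discWeight α z := by
    unfold discWeight
    simp only [Set.indicator, Set.mem_ofPred_eq, h1]
  rw [h2, h3]

/-! ### Translation measures -/

/-- `ρ` is a symmetric probability measure on `[-1, 1]` for which the generalized translations
`g ↦ ∫ g (s t + u √(1 - s²) √(1 - t²)) dρ(u)` preserve integrals with respect to the density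
`(1 - t^2)^α` on `[-1, 1]`. -/
structure IsTranslationMeasure (α : ℝ) (ρ : Measure ℝ) : Prop where
  isProbabilityMeasure : IsProbabilityMeasure ρ
  map_neg : ρ.map (fun u => -u) = ρ
  ae_abs_le : ∀ᵐ u ∂ρ, |u| ≤ 1
  lintegral_eq : ∀ s r : ℝ, s ^ 2 + r ^ 2 = 1 → ∀ g : ℝ → ℝ≥0∞, Measurable g →
    ∫⁻ t in Set.Icc (-1 : ℝ) 1, jacobiDensity α t *
        ∫⁻ u, g (s * t + u * (r * √(1 - t ^ 2))) ∂ρ =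
      ∫⁻ t in Set.Icc (-1 : ℝ) 1, jacobiDensity α t * g t

/-- Take `ρ` proportional to `(1 - u²)^{λ - 1}`, integrable because `λ > 0`. Then `(t, u √(1 - t²))`
sweeps out the weighted disc, and invariance is rotation invariance there. -/
lemma exists_isTranslationMeasure_of_pos {lam : ℝ} (hlam : 0 < lam) :
    ∃ ρ, IsTranslationMeasure (lam - 1 / 2) ρ := by
  set c := ∫⁻ t in Set.Icc (-1 : ℝ) 1, jacobiDensity (lam - 1) t with hc
  have hc0 : c ≠ 0 := lintegral_jacobiDensity_ne_zero _
  have hct : c ≠ ∞ := (lintegral_jacobiDensity_lt_top (by linarith)).ne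
  have hlint : ∀ g : ℝ → ℝ≥0∞, Measurable g →
      ∫⁻ u, g u ∂(c⁻¹ • (volume.restrict (Set.Icc (-1 : ℝ) 1)).withDensity
        (jacobiDensity (lam - 1))) =
      c⁻¹ * ∫⁻ u in Set.Icc (-1 : ℝ) 1, jacobiDensity (lam - 1) u * g u := by
    intro g hg
    rw [lintegral_smul_measure, lintegral_withDensity_eq_lintegral_mul _ (by fun_prop) hg]
    rfl
  refine ⟨c⁻¹ • (volume.restrict (Set.Icc (-1 : ℝ) 1)).withDensity (jacobiDensity (lam - 1)),
    ⟨?_, ?_, ?_, ?_⟩⟩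
  · constructor
    rw [Measure.smul_apply, withDensity_apply _ MeasurableSet.univ, Measure.restrict_univ, ← hc,
      smul_eq_mul, ENNReal.inv_mul_cancel hc0 hct]
  · refine Measure.ext_of_lintegral _ fun g hg => ?_
    rw [lintegral_map hg measurable_neg, hlint _ (by fun_prop), hlint _ hg]
    congr 1
    have := (Measure.measurePreserving_neg (volume : Measure ℝ)).setLIntegral_comp_preimage
        (measurableSet_Icc (a := (-1 : ℝ)) (b := 1))
        (f := fun u => jacobiDensity (lam - 1) u * g u) (by fun_prop)
    rw [← this]
    simp [jacobiDensity]
  · refine Measure.ae_smul_measure ?_ _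
    refine (withDensity_absolutelyContinuous _ _).ae_le ?_
    filter_upwards [ae_restrict_mem measurableSet_Icc] with u hu
    exact abs_le.2 hu
  · intro s r hsr g hg
    have hc1 : c⁻¹ ≠ ∞ := ENNReal.inv_ne_top.2 hc0
    have key : ∀ s r : ℝ, s ^ 2 + r ^ 2 = 1 →
      ∫⁻ t in Set.Icc (-1 : ℝ) 1, jacobiDensity (lam - 1 / 2) t *
        ∫⁻ u, g (s * t + u * (r * √(1 - t ^ 2))) ∂(c⁻¹ •
          (volume.restrict (Set.Icc (-1 : ℝ) 1)).withDensity (jacobiDensity (lam - 1))) =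
      c⁻¹ * ∫⁻ z : ℂ, discWeight (lam - 1) z * g z.re := by
      intro s r hsr
      rw [← lintegral_discWeight_rotate _ hsr g hg,
        ← lintegral_jacobiDensity_mul_lintegral_eq lam s r g hg, ← lintegral_const_mul' _ _ hc1]
      refine lintegral_congr fun t => ?_
      rw [hlint _ (by fun_prop)]
      ring
    -- For `(s, r) = (1, 0)` the inner integrand does not depend on `u`, so the disc integral
    -- collapses to the untranslated one.
    rw [key s r hsr, ← key 1 0 (by norm_num)]
    refine lintegral_congr fun t => ?_
    congr 1
    rw [hlint _ (by fun_prop)]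
    simp only [one_mul, zero_mul, mul_zero, add_zero]
    rw [lintegral_mul_const _ (by fun_prop), ← hc, ← mul_assoc, ENNReal.inv_mul_cancel hc0 hct,
      one_mul]

lemma lintegral_jacobiDensity_neg_half (g : ℝ → ℝ≥0∞) :
    ∫⁻ t in Set.Icc (-1 : ℝ) 1, jacobiDensity (-1 / 2) t * g t =
      ∫⁻ θ in Set.Ioo 0 Real.pi, g (Real.cos θ) := by
  have him : Real.cos '' Set.Ioo 0 Real.pi = Set.Ioo (-1) 1 := by
    ext x
    constructor
    · rintro ⟨θ, hθ, rfl⟩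
      have hs : 0 < Real.sin θ := Real.sin_pos_of_mem_Ioo hθ
      rw [Set.mem_Ioo, ← abs_lt, ← sq_lt_one_iff_abs_lt_one]
      nlinarith [Real.sin_sq_add_cos_sq θ]
    · intro hx
      exact ⟨Real.arccos x, ⟨Real.arccos_pos.2 hx.2, Real.arccos_lt_pi.2 hx.1⟩,
        Real.cos_arccos hx.1.le hx.2.le⟩
  rw [← setLIntegral_congr Ioo_ae_eq_Icc, ← him,
    lintegral_image_eq_lintegral_abs_deriv_mul measurableSet_Ioo
      (fun θ _ => (Real.hasDerivAt_cos θ).hasDerivWithinAt)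
      (Real.injOn_cos.mono Set.Ioo_subset_Icc_self)]
  refine setLIntegral_congr_fun measurableSet_Ioo fun θ hθ => ?_
  have hs : 0 < Real.sin θ := Real.sin_pos_of_mem_Ioo hθ
  have h1 : 1 - Real.cos θ ^ 2 = Real.sin θ ^ 2 := by rw [Real.sin_sq]
  simp only [jacobiDensity, h1, abs_neg, abs_of_pos hs]
  rw [← mul_assoc, ENNReal.ofReal_pow hs.le, ← ENNReal.rpow_natCast_mul]
  norm_num
  rw [ENNReal.rpow_neg_one, ENNReal.mul_inv_cancel (ENNReal.ofReal_pos.2 hs).ne'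
    ENNReal.ofReal_ne_top, one_mul]

/-- Reflecting `θ` turns the second integral into the first integrand over `(-π, 0)`. The sum is
thus an integral over a full period, independent of `φ`; compare with `φ = 0`. -/
lemma lintegral_Ioo_cos_add (φ : ℝ) (g : ℝ → ℝ≥0∞) :
    (∫⁻ θ in Set.Ioo 0 Real.pi, g (Real.cos (θ + φ))) +
      ∫⁻ θ in Set.Ioo 0 Real.pi, g (Real.cos (θ - φ)) =
    2 * ∫⁻ θ in Set.Ioo 0 Real.pi, g (Real.cos θ) := by
  have : Fact (0 < 2 * Real.pi) := ⟨Real.two_pi_pos⟩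
  have key : ∀ φ : ℝ, (∫⁻ θ in Set.Ioo 0 Real.pi, g (Real.cos (θ + φ))) +
      ∫⁻ θ in Set.Ioo 0 Real.pi, g (Real.cos (θ - φ)) =
      ∫⁻ b : AddCircle (2 * Real.pi), g (Real.Angle.cos b) := by
    intro φ
    have h1 : ∫⁻ θ in Set.Ioo 0 Real.pi, g (Real.cos (θ - φ)) =
        ∫⁻ θ in Set.Ioo (-Real.pi) 0, g (Real.cos (θ + φ)) := by
      have := (Measure.measurePreserving_neg (volume : Measure ℝ)).setLIntegral_comp_preimage_emb
        (MeasurableEquiv.neg ℝ).measurableEmbedding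
        (fun θ => g (Real.cos (θ + φ))) (Set.Ioo (-Real.pi) 0)
      rw [← this]
      simp only [Set.neg_preimage, Set.neg_Ioo, neg_zero, neg_neg]
      refine lintegral_congr fun θ => ?_
      rw [← Real.cos_neg]; congr 2; ring
    have h2 : ∫⁻ b : AddCircle (2 * Real.pi), g (Real.Angle.cos b) =
        ∫⁻ b : AddCircle (2 * Real.pi), g (Real.Angle.cos (b + ((φ : ℝ) : AddCircle (2 * Real.pi)) :)) :=
      (lintegral_add_right_eq_self (μ := (volume : Measure (AddCircle (2 * Real.pi))))
        (fun b : AddCircle (2 * Real.pi) => g (Real.Angle.cos b))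
        ((φ : ℝ) : AddCircle (2 * Real.pi))).symm
    rw [h1, h2, ← AddCircle.lintegral_preimage (2 * Real.pi) (-Real.pi),
      setLIntegral_congr Ioo_ae_eq_Ioc, setLIntegral_congr Ioo_ae_eq_Ioc, add_comm,
      ← lintegral_union measurableSet_Ioc, Set.Ioc_union_Ioc_eq_Ioc]
    · rw [show -Real.pi + 2 * Real.pi = Real.pi by ring]
      refine lintegral_congr fun θ => ?_
      rw [← Real.Angle.cos_coe, Real.Angle.coe_add]
      rfl
    · linarith [Real.pi_pos]
    · exact Real.pi_pos.le
    · exact Set.Ioc_disjoint_Ioc_of_le le_rfl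
  have h0 := key 0
  simp only [add_zero, sub_zero] at h0
  rw [key φ, ← h0, two_mul]

/-- At `λ = 0` the density `(1 - u²)^{-1}` is not integrable, and its role is taken by equal masses
at `±1`. With `t = cos θ`, `s = cos φ`, `r = sin φ`, translation averages `g` over `cos (θ ± φ)`. -/
lemma exists_isTranslationMeasure_zero : ∃ ρ, IsTranslationMeasure (-1 / 2) ρ := by
  refine ⟨(2⁻¹ : ℝ≥0∞) • (Measure.dirac 1 + Measure.dirac (-1)), ⟨⟨?_⟩, ?_, ?_, ?_⟩⟩
  · simp only [Measure.smul_apply, Measure.add_apply, measure_univ, smul_eq_mul]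
    norm_num
    exact ENNReal.inv_mul_cancel (by norm_num) (by norm_num)
  · change Measure.map Neg.neg _ = _
    rw [Measure.map_smul, Measure.map_add _ _ measurable_neg, Measure.map_dirac' measurable_neg,
      Measure.map_dirac' measurable_neg, neg_neg, add_comm]
  · refine Measure.ae_smul_measure ?_ _
    rw [ae_add_measure_iff, ae_dirac_iff, ae_dirac_iff]
    · simp
    all_goals exact measurableSet_le (by fun_prop) (by fun_prop)
  · intro s r hsr g hg
    obtain ⟨φ, hs, hr⟩ : ∃ φ : ℝ, Real.cos φ = s ∧ Real.sin φ = r := by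
      have hz : ‖(⟨s, r⟩ : ℂ)‖ = 1 := by
        rw [← sq_eq_sq₀ (norm_nonneg _) zero_le_one, ← Complex.normSq_eq_norm_sq,
          Complex.normSq_mk]
        nlinarith
      have h1 := Complex.norm_mul_cos_arg ⟨s, r⟩
      have h2 := Complex.norm_mul_sin_arg ⟨s, r⟩
      rw [hz, one_mul] at h1 h2
      exact ⟨_, h1, h2⟩
    rw [lintegral_jacobiDensity_neg_half, lintegral_jacobiDensity_neg_half]
    have h2 : ∫⁻ θ in Set.Ioo 0 Real.pi, g (Real.cos θ) =
        2⁻¹ * (2 * ∫⁻ θ in Set.Ioo 0 Real.pi, g (Real.cos θ)) := by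
      rw [← mul_assoc, ENNReal.inv_mul_cancel (by norm_num) (by norm_num), one_mul]
    rw [h2, ← lintegral_Ioo_cos_add φ g, ← lintegral_add_left (by fun_prop),
      ← lintegral_const_mul _ (by fun_prop)]
    refine setLIntegral_congr_fun measurableSet_Ioo fun θ hθ => ?_
    have hsin : 0 < Real.sin θ := Real.sin_pos_of_mem_Ioo hθ
    have h1 : √(1 - Real.cos θ ^ 2) = Real.sin θ := by
      rw [← Real.sin_sq, Real.sqrt_sq hsin.le]
    simp only [lintegral_smul_measure, lintegral_add_measure, lintegral_dirac, smul_eq_mul, h1]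
    rw [Real.cos_add, Real.cos_sub, hs, hr, add_comm (g _)]
    congr 3 <;> ring_nf

theorem exists_isTranslationMeasure {lam : ℝ} (hlam : 0 ≤ lam) :
    ∃ ρ, IsTranslationMeasure (lam - 1 / 2) ρ := by
  rcases hlam.eq_or_lt with rfl | h
  · simpa [neg_div] using exists_isTranslationMeasure_zero
  · exact exists_isTranslationMeasure_of_pos h

/-! ### Generalized translation of polynomials -/

namespace IsTranslationMeasure

variable {α : ℝ} {ρ : Measure ℝ}

lemma integrable_pow (hρ : IsTranslationMeasure α ρ) (n : ℕ) :
    Integrable (fun u : ℝ => u ^ n) ρ := by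
  have := hρ.isProbabilityMeasure
  refine Integrable.of_bound (by fun_prop) 1 ?_
  filter_upwards [hρ.ae_abs_le] with u hu
  rw [norm_pow]
  exact pow_le_one₀ (norm_nonneg _) hu

lemma integral_pow_odd (hρ : IsTranslationMeasure α ρ) {n : ℕ} (hn : Odd n) :
    ∫ u, u ^ n ∂ρ = 0 := by
  have h : ∫ u, u ^ n ∂ρ = -∫ u, u ^ n ∂ρ := by
    conv_lhs => rw [← hρ.map_neg]
    rw [integral_map (by fun_prop) (by fun_prop)]
    simp only [hn.neg_pow, integral_neg]
  linarith

lemma exists_polynomial_eq_integral_pow (hρ : IsTranslationMeasure α ρ) (s r : ℝ) (n : ℕ) :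
    ∃ q : Polynomial ℝ, q.natDegree ≤ n ∧ ∀ t ∈ Set.Icc (-1 : ℝ) 1,
      ∫ u, (s * t + u * (r * √(1 - t ^ 2))) ^ n ∂ρ = q.eval t := by
  -- Binomial expansion, with `√(1 - t²)^(n - k)` written as `(1 - t²)^((n - k) / 2)`. The rounding
  -- for odd `n - k` is harmless since the moment factor is then zero.
  refine ⟨∑ k ∈ Finset.range (n + 1), Polynomial.C (s ^ k * r ^ (n - k) * (n.choose k) *
    ∫ u, u ^ (n - k) ∂ρ) * (Polynomial.X ^ k * (1 - Polynomial.X ^ 2) ^ ((n - k) / 2)), ?_, ?_⟩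
  · refine Polynomial.natDegree_sum_le_of_forall_le _ _ fun k hk => ?_
    have hk' := Finset.mem_range.1 hk
    refine (Polynomial.natDegree_C_mul_le _ _).trans (Polynomial.natDegree_mul_le.trans ?_)
    have h1 : (1 - Polynomial.X ^ 2 : Polynomial ℝ).natDegree ≤ 2 := by compute_degree
    have h2 := Polynomial.natDegree_pow_le_of_le ((n - k) / 2) h1
    rw [Polynomial.natDegree_X_pow]
    omega
  · intro t ht
    have h0 : 0 ≤ 1 - t ^ 2 := by nlinarith [ht.1, ht.2]
    simp only [add_pow, mul_pow]
    rw [integral_finsetSum, Polynomial.eval_finsetSum]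
    · refine Finset.sum_congr rfl fun k _ => ?_
      rw [integral_mul_const, integral_const_mul, integral_mul_const]
      simp only [Polynomial.eval_mul, Polynomial.eval_C, Polynomial.eval_pow, Polynomial.eval_sub,
        Polynomial.eval_one, Polynomial.eval_X]
      rcases Nat.even_or_odd (n - k) with he | ho
      · have : √(1 - t ^ 2) ^ (n - k) = (1 - t ^ 2) ^ ((n - k) / 2) := by
          conv_lhs => rw [← Nat.two_mul_div_two_of_even he, pow_mul, Real.sq_sqrt h0]
        rw [this]
        ring
      · rw [hρ.integral_pow_odd ho]
        ring
    · intro k _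
      exact (((hρ.integrable_pow _).mul_const _).const_mul _).mul_const _

end IsTranslationMeasure

lemma continuous_polyFun {m : ℕ} (P : MvPolynomial (Fin m) ℂ) : Continuous (polyFun P) := by
  unfold polyFun
  exact (MvPolynomial.continuous_eval P).comp (by fun_prop)

lemma polyFun_add {m : ℕ} (P Q : MvPolynomial (Fin m) ℂ) (x : Fin m → ℝ) :
    polyFun (P + Q) x = polyFun P x + polyFun Q x := by simp [polyFun]

lemma polyFun_smul {m : ℕ} (c : ℂ) (P : MvPolynomial (Fin m) ℂ) (x : Fin m → ℝ) :
    polyFun (c • P) x = c * polyFun P x := by simp [polyFun]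

lemma polyFun_monomial {m : ℕ} (k : Fin m →₀ ℕ) (x : Fin m → ℝ) :
    polyFun (MvPolynomial.monomial k 1) x = ((∏ i, x i ^ k i : ℝ) : ℂ) := by
  simp [polyFun, MvPolynomial.eval_monomial, Finsupp.prod_fintype]

lemma IsTranslationMeasure.integrable_polyFun {m : ℕ} {α : ℝ} {ρ : Measure ℝ}
    (hρ : IsTranslationMeasure α ρ) (P : MvPolynomial (Fin m) ℂ) (x : Fin m → ℝ) (j : Fin m)
    (b c : ℝ) : Integrable (fun u => polyFun P (Function.update x j (b + u * c))) ρ := by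
  have := hρ.isProbabilityMeasure
  have hc : Continuous fun u : ℝ => polyFun P (Function.update x j (b + u * c)) :=
    (continuous_polyFun P).comp (by fun_prop)
  obtain ⟨C, hC⟩ := (isCompact_Icc (a := (-1 : ℝ)) (b := 1)).exists_bound_of_continuousOn
    hc.continuousOn
  refine Integrable.of_bound hc.aestronglyMeasurable C ?_
  filter_upwards [hρ.ae_abs_le] with u hu using hC u (abs_le.1 hu)

/-- Generalized translation in the `j`-th variable maps polynomials with exponents in a lower set
to polynomials of the same kind. -/
lemma exists_polyFun_eq_integral {m : ℕ} {S : Set (Fin m →₀ ℕ)} (hS : IsLowerSet S) {α : ℝ}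
    {ρ : Measure ℝ} (hρ : IsTranslationMeasure α ρ) (j : Fin m) (s r : ℝ)
    {h : MvPolynomial (Fin m) ℂ} (hh : h ∈ MvPolynomial.restrictSupport ℂ S) :
    ∃ Q ∈ MvPolynomial.restrictSupport ℂ S, ∀ x : Fin m → ℝ, x j ∈ Set.Icc (-1 : ℝ) 1 →
      polyFun Q x =
        ∫ u, polyFun h (Function.update x j (s * x j + u * (r * √(1 - x j ^ 2)))) ∂ρ := by
  rw [MvPolynomial.restrictSupport_eq_span] at hh
  induction hh using Submodule.span_induction with
  | mem h hh =>
    obtain ⟨k, hk, rfl⟩ := hh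
    obtain ⟨q, hqd, hq⟩ := hρ.exists_polynomial_eq_integral_pow s r (k j)
    -- Translation replaces `x_j ^ k_j` by `q(x_j)`; only the `j`-th exponent changes, and it does
    -- not increase.
    refine ⟨∑ l ∈ Finset.range (k j + 1), (q.coeff l : ℂ) •
      MvPolynomial.monomial (k.update j l) 1, ?_, ?_⟩
    · refine Submodule.sum_mem _ fun l hl => Submodule.smul_mem _ _ ?_
      rw [MvPolynomial.monomial_mem_restrictSupport]
      refine Or.inl (hS ?_ hk)
      intro i
      rcases eq_or_ne i j with rfl | hi
      · simpa using Nat.lt_succ_iff.1 (Finset.mem_range.1 hl)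
      · simp [Function.update_of_ne hi]
    · intro x hx
      have hprod : ∀ (k' : Fin m →₀ ℕ) (y : Fin m → ℝ), (∀ i ≠ j, k' i = k i ∧ y i = x i) →
          ∏ i, y i ^ k' i = y j ^ k' j * ∏ i ∈ Finset.univ.erase j, x i ^ k i := by
        intro k' y hy
        rw [← Finset.mul_prod_erase _ _ (Finset.mem_univ j)]
        congr 1
        refine Finset.prod_congr rfl fun i hi => ?_
        rw [(hy i (Finset.ne_of_mem_erase hi)).1, (hy i (Finset.ne_of_mem_erase hi)).2]
      have e1 : ∀ u : ℝ, polyFun (MvPolynomial.monomial k 1)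
          (Function.update x j (s * x j + u * (r * √(1 - x j ^ 2)))) =
          (((s * x j + u * (r * √(1 - x j ^ 2))) ^ k j *
            ∏ i ∈ Finset.univ.erase j, x i ^ k i : ℝ) : ℂ) := by
        intro u
        rw [polyFun_monomial, hprod k _ fun i hi => ⟨rfl, Function.update_of_ne hi _ _⟩,
          Function.update_self]
      simp only [e1]
      rw [integral_complex_ofReal, integral_mul_const, hq _ hx,
        Polynomial.eval_eq_sum_range' (Nat.lt_succ_of_le hqd), Finset.sum_mul, Complex.ofReal_sum]
      simp only [polyFun, map_sum]
      refine Finset.sum_congr rfl fun l _ => ?_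
      have := polyFun_smul (q.coeff l : ℂ) (MvPolynomial.monomial (k.update j l) 1) x
      simp only [polyFun] at this
      rw [this]
      have := polyFun_monomial (k.update j l) x
      simp only [polyFun] at this
      rw [this, hprod (k.update j l) x fun i hi => ⟨by simp [Function.update_of_ne hi], rfl⟩]
      simp [mul_assoc]
  | zero => exact ⟨0, Submodule.zero_mem _, fun x _ => by simp [polyFun]⟩
  | add h₁ h₂ _ _ ih₁ ih₂ =>
    obtain ⟨Q₁, hQ₁, e₁⟩ := ih₁
    obtain ⟨Q₂, hQ₂, e₂⟩ := ih₂
    refine ⟨Q₁ + Q₂, Submodule.add_mem _ hQ₁ hQ₂, fun x hx => ?_⟩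
    simp only [polyFun_add]
    rw [integral_add (hρ.integrable_polyFun _ _ _ _ _) (hρ.integrable_polyFun _ _ _ _ _),
      e₁ x hx, e₂ x hx]
  | smul c h _ ih =>
    obtain ⟨Q, hQ, e⟩ := ih
    refine ⟨c • Q, Submodule.smul_mem _ _ hQ, fun x hx => ?_⟩
    simp only [polyFun_smul]
    rw [integral_const_mul, e x hx]

/-! ### Contraction in the weighted norm -/

lemma cube_eq_pi (m : ℕ) : cube m = Set.univ.pi fun _ => Set.Icc (-1 : ℝ) 1 := by
  ext x
  rw [Set.mem_univ_pi]
  exact forall_congr' fun j => abs_le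

lemma measurableSet_cube (m : ℕ) : MeasurableSet (cube m) := by
  rw [cube_eq_pi]
  exact MeasurableSet.univ_pi fun _ => measurableSet_Icc

lemma volume_restrict_cube (m : ℕ) : (volume.restrict (cube m)) =
    Measure.pi fun _ => (volume : Measure ℝ).restrict (Set.Icc (-1 : ℝ) 1) := by
  rw [cube_eq_pi, volume_pi, Measure.restrict_pi_pi]

lemma gegenbauerWeight_eq_prod {m : ℕ} (lam x : Fin m → ℝ) :
    gegenbauerWeight lam x = ∏ j, jacobiDensity (lam j - 1 / 2) (x j) := rfl

@[fun_prop]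
lemma measurable_gegenbauerWeight {m : ℕ} (lam : Fin m → ℝ) :
    Measurable (gegenbauerWeight lam) := by
  unfold gegenbauerWeight
  fun_prop

lemma weightedLpNorm_eq {m : ℕ} {p : ℝ} (hp : 0 < p) (lam : Fin m → ℝ)
    {F : (Fin m → ℝ) → ℂ} (hF : Continuous F) :
    weightedLpNorm p (gegenbauerWeight lam) (cube m) F =
      (∫⁻ x, gegenbauerWeight lam x * ‖F x‖ₑ ^ p
        ∂(Measure.pi fun _ => (volume : Measure ℝ).restrict (Set.Icc (-1 : ℝ) 1))) ^ (1 / p) := by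
  have hm := hF.measurable
  rw [weightedLpNorm, eLpNorm_eq_lintegral_rpow_enorm_toReal (by simpa using hp)
    ENNReal.ofReal_ne_top, ENNReal.toReal_ofReal hp.le,
    lintegral_withDensity_eq_lintegral_mul _ (by fun_prop) (by fun_prop), volume_restrict_cube]
  rfl

/-- Jensen's inequality, via monotonicity of `L_p` norms in the exponent on a probability space. -/
lemma enorm_integral_rpow_le {ρ : Measure ℝ} [IsProbabilityMeasure ρ] {p : ℝ} (hp : 1 ≤ p)
    {f : ℝ → ℂ} (hf : Continuous f) : ‖∫ u, f u ∂ρ‖ₑ ^ p ≤ ∫⁻ u, ‖f u‖ₑ ^ p ∂ρ := by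
  have hp0 : 0 < p := by linarith
  have h1 : ‖∫ u, f u ∂ρ‖ₑ ≤ eLpNorm f (ENNReal.ofReal p) ρ := by
    refine (enorm_integral_le_lintegral_enorm f).trans ?_
    rw [← eLpNorm_one_eq_lintegral_enorm]
    refine eLpNorm_le_eLpNorm_of_exponent_le ?_ hf.aestronglyMeasurable
    simpa using hp
  rw [eLpNorm_eq_lintegral_rpow_enorm_toReal (by simpa using hp0)
    ENNReal.ofReal_ne_top, ENNReal.toReal_ofReal hp0.le] at h1
  calc _ ≤ _ := ENNReal.rpow_le_rpow h1 hp0.le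
    _ = _ := by rw [← ENNReal.rpow_mul, one_div_mul_cancel hp0.ne', ENNReal.rpow_one]

/-- Generalized translation in one variable is a contraction in the weighted `L_p`-norm. -/
lemma weightedLpNorm_translate_le {m : ℕ} {p : ℝ} (hp : 1 ≤ p) (lam : Fin m → ℝ) (j : Fin m)
    {ρ : Measure ℝ} (hρ : IsTranslationMeasure (lam j - 1 / 2) ρ) {s r : ℝ}
    (hsr : s ^ 2 + r ^ 2 = 1) {h Q : MvPolynomial (Fin m) ℂ}
    (hQ : ∀ x : Fin m → ℝ, x j ∈ Set.Icc (-1 : ℝ) 1 → polyFun Q x =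
      ∫ u, polyFun h (Function.update x j (s * x j + u * (r * √(1 - x j ^ 2)))) ∂ρ) :
    weightedLpNorm p (gegenbauerWeight lam) (cube m) (polyFun Q) ≤
      weightedLpNorm p (gegenbauerWeight lam) (cube m) (polyFun h) := by
  have hp0 : 0 < p := by linarith
  have := hρ.isProbabilityMeasure
  have hcQ := continuous_polyFun Q
  have hch := continuous_polyFun h
  have hmQ := hcQ.measurable
  have hmh := hch.measurable
  rw [weightedLpNorm_eq hp0 lam hcQ, weightedLpNorm_eq hp0 lam hch]
  refine ENNReal.rpow_le_rpow ?_ (by positivity)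
  -- By Tonelli it suffices to compare integrals in the `j`-th variable; the other weight factors
  -- form the constant `K`.
  refine lintegral_le_of_lmarginal_le {j} (by fun_prop) (by fun_prop) fun x => ?_
  rw [lmarginal_singleton, lmarginal_singleton]
  set K : ℝ≥0∞ := ∏ i ∈ Finset.univ.erase j, jacobiDensity (lam i - 1 / 2) (x i)
  have hW : ∀ t, gegenbauerWeight lam (Function.update x j t) =
      K * jacobiDensity (lam j - 1 / 2) t := by
    intro t
    rw [gegenbauerWeight_eq_prod, ← Finset.prod_erase_mul _ _ (Finset.mem_univ j),
      Function.update_self]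
    congr 1
    refine Finset.prod_congr rfl fun i hi => ?_
    rw [Function.update_of_ne (Finset.ne_of_mem_erase hi)]
  set g : ℝ → ℝ≥0∞ := fun y => ‖polyFun h (Function.update x j y)‖ₑ ^ p with hg
  have hgm : Measurable g := by fun_prop
  have hinv := hρ.lintegral_eq s r hsr g hgm
  have hQm : Measurable fun t => ‖polyFun Q (Function.update x j t)‖ₑ ^ p := by fun_prop
  simp only [hW, mul_assoc]
  rw [lintegral_const_mul _ (by fun_prop), lintegral_const_mul _ (by fun_prop)]
  refine mul_le_mul' le_rfl (le_trans ?_ hinv.le)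
  refine setLIntegral_mono' measurableSet_Icc fun t ht => ?_
  refine mul_le_mul' le_rfl ?_
  have := hQ (Function.update x j t) (by simpa using ht)
  rw [Function.update_self] at this
  simp only [Function.update_idem] at this
  rw [this]
  exact enorm_integral_rpow_le hp (hch.comp (by fun_prop))

/-! ### Sup and weighted norms of polynomials on the cube -/

section Measures

variable {m : ℕ}

lemma lmarginal_prod_eq {ι : Type*} [DecidableEq ι] {X : ι → Type*} [∀ i, MeasurableSpace (X i)]
    (μ : ∀ i, Measure (X i)) [∀ i, SigmaFinite (μ i)] (s : Finset ι) (f : ∀ i, X i → ℝ≥0∞)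
    (hf : ∀ i, Measurable (f i)) :
    lmarginal μ s (fun x => ∏ i ∈ s, f i (x i)) = fun _ => ∏ i ∈ s, ∫⁻ t, f i t ∂μ i := by
  induction s using Finset.induction_on with
  | empty => simp
  | insert j s hj ih =>
    have hm : ∀ s : Finset ι, Measurable fun x : ∀ i, X i => ∏ i ∈ s, f i (x i) := fun s =>
      Finset.measurable_fun_prod _ fun i _ => (hf i).comp (measurable_pi_apply i)
    rw [lmarginal_insert' _ (hm _) hj]
    have h1 : (fun x : ∀ i, X i => ∫⁻ t, ∏ i ∈ insert j s, f i (Function.update x j t i) ∂μ j) =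
        fun x => (∫⁻ t, f j t ∂μ j) * ∏ i ∈ s, f i (x i) := by
      funext x
      rw [← lintegral_mul_const _ (hf j)]
      refine lintegral_congr fun t => ?_
      rw [Finset.prod_insert hj, Function.update_self]
      congr 1
      refine Finset.prod_congr rfl fun i hi => ?_
      rw [Function.update_of_ne (by rintro rfl; exact hj hi)]
    rw [h1, Finset.prod_insert hj]
    funext x
    have h2 := congrFun ih x
    simp only [lmarginal] at h2 ⊢
    have h3 : Measurable fun y : ∀ i : s, X i =>
        ∏ i ∈ s, f i (Function.updateFinset x s y i) :=
      (hm s).comp measurable_updateFinset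
    rw [lintegral_const_mul _ h3, h2]

lemma isFiniteMeasure_gegenbauer {lam : Fin m → ℝ} (hlam : ∀ j, 0 ≤ lam j) :
    IsFiniteMeasure ((volume.restrict (cube m)).withDensity (gegenbauerWeight lam)) := by
  refine isFiniteMeasure_withDensity (ne_of_lt ?_)
  rw [volume_restrict_cube, lintegral_eq_lmarginal_univ 0]
  have := lmarginal_prod_eq (fun _ : Fin m => (volume : Measure ℝ).restrict (Set.Icc (-1) 1))
    Finset.univ (fun j => jacobiDensity (lam j - 1 / 2)) fun j => by fun_prop
  rw [show gegenbauerWeight lam = fun x => ∏ j, jacobiDensity (lam j - 1 / 2) (x j) from rfl, this]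
  exact ENNReal.prod_lt_top fun j _ =>
    lintegral_jacobiDensity_lt_top (by linarith [hlam j])

/-- The open cube `(-1, 1)^m`. -/
def openCube (m : ℕ) : Set (Fin m → ℝ) := Set.univ.pi fun _ => Set.Ioo (-1 : ℝ) 1

lemma isOpen_openCube : IsOpen (openCube m) :=
  isOpen_set_pi Set.finite_univ fun _ _ => isOpen_Ioo

lemma openCube_ae_eq_cube : openCube m =ᵐ[volume] cube m := by
  rw [cube_eq_pi, Set.pi_univ_Icc]
  exact Measure.univ_pi_Ioo_ae_eq_Icc

lemma volume_restrict_cube_eq_openCube :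
    volume.restrict (cube m) = volume.restrict (openCube m) :=
  (Measure.restrict_congr_set openCube_ae_eq_cube).symm

lemma cube_subset_closure_openCube : cube m ⊆ closure (openCube m) := by
  rw [openCube, closure_pi_set, cube_eq_pi]
  simp only [closure_Ioo (show (-1 : ℝ) ≠ 1 by norm_num), subset_rfl]

lemma isCompact_cube : IsCompact (cube m) := by
  rw [cube_eq_pi]
  exact isCompact_univ_pi fun _ => isCompact_Icc

lemma eq_zero_of_eqOn_openCube {P : MvPolynomial (Fin m) ℂ}
    (h : ∀ x ∈ openCube m, polyFun P x = 0) : P = 0 := by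
  refine MvPolynomial.funext_set (fun _ => ((↑) : ℝ → ℂ) '' Set.Ioo (-1 : ℝ) 1)
    (fun _ => (Set.Ioo_infinite (by norm_num)).image Complex.ofReal_injective.injOn) ?_
  intro z hz
  choose x hx hxz using fun i => hz i (Set.mem_univ i)
  have hz' : z = fun i => (x i : ℂ) := funext fun i => (hxz i).symm
  rw [hz', map_zero]
  exact h x fun i _ => hx i

/-- By continuity, the part of the open cube where the essential bound fails is open and null, hence
empty; the bound passes to the faces by closure. -/
lemma enorm_le_supNorm (P : MvPolynomial (Fin m) ℂ) {x : Fin m → ℝ} (hx : x ∈ cube m) :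
    ‖polyFun P x‖ₑ ≤ supNorm (cube m) (polyFun P) := by
  set c := supNorm (cube m) (polyFun P) with hc
  have hcont : Continuous fun x => ‖polyFun P x‖ₑ := (continuous_polyFun P).enorm
  have hclosed : IsClosed {x | ‖polyFun P x‖ₑ ≤ c} := isClosed_le hcont continuous_const
  suffices h : openCube m ⊆ {x | ‖polyFun P x‖ₑ ≤ c} from
    closure_minimal h hclosed (cube_subset_closure_openCube hx)
  have hae : ∀ᵐ x ∂volume.restrict (openCube m), ‖polyFun P x‖ₑ ≤ c := by
    rw [← volume_restrict_cube_eq_openCube, hc, supNorm, eLpNorm_exponent_top]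
    exact enorm_ae_le_eLpNormEssSup _ _
  have hopen : IsOpen ({x | ‖polyFun P x‖ₑ ≤ c}ᶜ ∩ openCube m) :=
    hclosed.isOpen_compl.inter isOpen_openCube
  have hnull : volume ({x | ‖polyFun P x‖ₑ ≤ c}ᶜ ∩ openCube m) = 0 := by
    rw [← Measure.restrict_apply hclosed.isOpen_compl.measurableSet]
    exact hae
  have hempty := hopen.measure_eq_zero_iff volume |>.1 hnull
  intro y hy
  by_contra hyc
  exact Set.notMem_empty y (hempty ▸ ⟨hyc, hy⟩)

lemma exists_supNorm_eq (P : MvPolynomial (Fin m) ℂ) :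
    ∃ x ∈ cube m, supNorm (cube m) (polyFun P) = ‖polyFun P x‖ₑ := by
  have hne : (cube m).Nonempty := ⟨0, fun j => by simp⟩
  obtain ⟨x, hx, hmax⟩ := isCompact_cube.exists_isMaxOn hne
    (continuous_polyFun P).enorm.continuousOn
  refine ⟨x, hx, le_antisymm ?_ (enorm_le_supNorm P hx)⟩
  rw [supNorm, eLpNorm_exponent_top]
  refine eLpNormEssSup_le_of_ae_enorm_bound ?_
  filter_upwards [ae_restrict_mem (measurableSet_cube m)] with y hy using hmax hy

lemma supNorm_ne_top (P : MvPolynomial (Fin m) ℂ) : supNorm (cube m) (polyFun P) ≠ ∞ := by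
  obtain ⟨x, _, h⟩ := exists_supNorm_eq P
  rw [h]
  exact enorm_ne_top

lemma supNorm_ne_zero {P : MvPolynomial (Fin m) ℂ} (hP : P ≠ 0) :
    supNorm (cube m) (polyFun P) ≠ 0 := by
  intro h
  refine hP (eq_zero_of_eqOn_openCube fun x hx => ?_)
  have hxc : x ∈ cube m := by
    rw [cube_eq_pi]
    exact fun i hi => Set.Ioo_subset_Icc_self (hx i hi)
  have := enorm_le_supNorm P hxc
  rw [h] at this
  simpa using this

lemma memLp_polyFun (P : MvPolynomial (Fin m) ℂ) (q : ℝ≥0∞) {lam : Fin m → ℝ}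
    (hlam : ∀ j, 0 ≤ lam j) :
    MemLp (polyFun P) q ((volume.restrict (cube m)).withDensity (gegenbauerWeight lam)) := by
  have := isFiniteMeasure_gegenbauer hlam
  obtain ⟨C, hC⟩ := (isCompact_cube (m := m)).exists_bound_of_continuousOn
    (continuous_polyFun P).continuousOn
  refine MemLp.of_bound (continuous_polyFun P).aestronglyMeasurable C ?_
  refine (withDensity_absolutelyContinuous _ _).ae_le ?_
  filter_upwards [ae_restrict_mem (measurableSet_cube m)] with y hy using hC y hy

lemma memLp_top_polyFun (P : MvPolynomial (Fin m) ℂ) :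
    MemLp (polyFun P) ∞ (volume.restrict (cube m)) :=
  ⟨(continuous_polyFun P).aestronglyMeasurable, (supNorm_ne_top P).lt_top⟩

lemma weightedLpNorm_ne_top (P : MvPolynomial (Fin m) ℂ) (p : ℝ) {lam : Fin m → ℝ}
    (hlam : ∀ j, 0 ≤ lam j) :
    weightedLpNorm p (gegenbauerWeight lam) (cube m) (polyFun P) ≠ ∞ :=
  (memLp_polyFun P _ hlam).eLpNorm_ne_top

/-- The weight is positive on the open cube, so a null norm makes `P` vanish there almost
everywhere, then everywhere by continuity. -/
lemma weightedLpNorm_ne_zero {P : MvPolynomial (Fin m) ℂ} (hP : P ≠ 0) {p : ℝ} (hp : 0 < p)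
    (lam : Fin m → ℝ) :
    weightedLpNorm p (gegenbauerWeight lam) (cube m) (polyFun P) ≠ 0 := by
  intro h
  rw [weightedLpNorm, eLpNorm_eq_zero_iff (continuous_polyFun P).aestronglyMeasurable
    (by simpa using hp)] at h
  have hac : volume.restrict (openCube m) ≪
      (volume.restrict (cube m)).withDensity (gegenbauerWeight lam) := by
    rw [volume_restrict_cube_eq_openCube]
    refine withDensity_absolutelyContinuous' (by fun_prop) ?_
    filter_upwards [ae_restrict_mem isOpen_openCube.measurableSet] with x hx
    rw [gegenbauerWeight_eq_prod]
    exact Finset.prod_ne_zero_iff.2 fun j _ => (jacobiDensity_pos (hx j (Set.mem_univ j))).ne'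
  exact hP (eq_zero_of_eqOn_openCube (Measure.eqOn_open_of_ae_eq (hac.ae_le h) isOpen_openCube
    (continuous_polyFun P).continuousOn continuousOn_const))

/-- The linear map sending a polynomial to its class in `L_q`. -/
noncomputable def polyToLp (q : ℝ≥0∞) (μ : Measure (Fin m → ℝ)) [Fact (1 ≤ q)]
    (hμ : ∀ P : MvPolynomial (Fin m) ℂ, MemLp (polyFun P) q μ) :
    MvPolynomial (Fin m) ℂ →ₗ[ℂ] Lp ℂ q μ where
  toFun P := (hμ P).toLp
  map_add' P Q := by
    rw [← MemLp.toLp_add]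
    exact MemLp.toLp_congr _ _ (Filter.Eventually.of_forall (polyFun_add P Q))
  map_smul' c P := by
    rw [RingHom.id_apply, ← MemLp.toLp_const_smul]
    exact MemLp.toLp_congr _ _ (Filter.Eventually.of_forall (polyFun_smul c P))

lemma enorm_polyToLp (q : ℝ≥0∞) (μ : Measure (Fin m → ℝ)) [Fact (1 ≤ q)]
    (hμ : ∀ P : MvPolynomial (Fin m) ℂ, MemLp (polyFun P) q μ) (P : MvPolynomial (Fin m) ℂ) :
    ‖polyToLp q μ hμ P‖ₑ = eLpNorm (polyFun P) q μ :=
  Lp.enorm_toLp (hμ P)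

end Measures

/-! ### Existence of extremal polynomials -/

/-- On a nontrivial finite-dimensional space, the ratio of two (semi)norms is maximized. -/
lemma exists_forall_norm_mul_le {E F G : Type*} [AddCommGroup E] [Module ℂ E]
    [FiniteDimensional ℂ E] [Nontrivial E] [NormedAddCommGroup F] [NormedSpace ℂ F]
    [NormedAddCommGroup G] [NormedSpace ℂ G] (A : E →ₗ[ℂ] F) (B : E →ₗ[ℂ] G)
    (hB : Function.Injective B) :
    ∃ e ≠ 0, ∀ h, ‖A h‖ * ‖B e‖ ≤ ‖A e‖ * ‖B h‖ := by
  let φ := (Module.finBasis ℂ E).equivFun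
  have hn : Nontrivial (Fin (Module.finrank ℂ E) → ℂ) := φ.symm.toEquiv.nontrivial
  have hBpos : ∀ h ≠ 0, 0 < ‖B h‖ := fun h hh =>
    norm_pos_iff.2 fun h0 => hh (hB (h0.trans (map_zero B).symm))
  have hA' : Continuous (A ∘ₗ φ.symm.toLinearMap) := LinearMap.continuous_of_finiteDimensional _
  have hB' : Continuous (B ∘ₗ φ.symm.toLinearMap) := LinearMap.continuous_of_finiteDimensional _
  have hsph : ∀ v ∈ Metric.sphere (0 : Fin (Module.finrank ℂ E) → ℂ) 1, φ.symm v ≠ 0 := by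
    intro v hv h0
    have : v = 0 := by simpa using h0
    simp [this] at hv
  have hne : (Metric.sphere (0 : Fin (Module.finrank ℂ E) → ℂ) 1).Nonempty := by
    obtain ⟨v, hv⟩ := exists_ne (0 : Fin (Module.finrank ℂ E) → ℂ)
    exact ⟨((‖v‖⁻¹ : ℝ) : ℂ) • v, by simp [norm_smul, hv]⟩
  obtain ⟨v, hv, hmax⟩ := (isCompact_sphere (0 : Fin (Module.finrank ℂ E) → ℂ) 1).exists_isMaxOn
    hne (f := fun v => ‖A (φ.symm v)‖ / ‖B (φ.symm v)‖)
    (ContinuousOn.div hA'.norm.continuousOn hB'.norm.continuousOn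
      fun v hv => (hBpos _ (hsph v hv)).ne')
  refine ⟨φ.symm v, hsph v hv, fun h => ?_⟩
  rcases eq_or_ne h 0 with rfl | hh
  · simp
  have hφ : φ h ≠ 0 := by simpa using hh
  have hφ' : 0 < ‖φ h‖ := norm_pos_iff.2 hφ
  have := hmax (a := ((‖φ h‖⁻¹ : ℝ) : ℂ) • φ h) (by simp [norm_smul, hφ])
  simp only [Set.mem_ofPred_eq, map_smul, LinearEquiv.symm_apply_apply, norm_smul] at this
  rw [mul_div_mul_left _ _ (by simp [hφ]), div_le_div_iff₀ (hBpos _ hh) (hBpos _ (hsph v hv))]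
    at this
  exact this

/-- Extremal polynomials exist in finite-dimensional spaces of polynomials. -/
lemma exists_isExtremalPolynomial {m : ℕ} (B : Submodule ℂ (MvPolynomial (Fin m) ℂ))
    [FiniteDimensional ℂ B] [Nontrivial B] {p : ℝ} (hp : 1 ≤ p) {lam : Fin m → ℝ}
    (hlam : ∀ j, 0 ≤ lam j) :
    ∃ P, IsExtremalPolynomial B p (gegenbauerWeight lam) (cube m) P := by
  have hp0 : 0 < p := by linarith
  have : Fact (1 ≤ ENNReal.ofReal p) := ⟨by simpa using hp⟩
  let T₁ := polyToLp ∞ (volume.restrict (cube m)) memLp_top_polyFun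
  let T₂ := polyToLp (ENNReal.ofReal p)
    ((volume.restrict (cube m)).withDensity (gegenbauerWeight lam))
    fun P => memLp_polyFun P _ hlam
  have e₁ : ∀ P, ‖T₁ P‖ₑ = supNorm (cube m) (polyFun P) := fun P => enorm_polyToLp _ _ _ P
  have e₂ : ∀ P, ‖T₂ P‖ₑ = weightedLpNorm p (gegenbauerWeight lam) (cube m) (polyFun P) :=
    fun P => enorm_polyToLp _ _ _ P
  have hinj : Function.Injective (T₂ ∘ₗ B.subtype) := by
    rw [← LinearMap.ker_eq_bot, LinearMap.ker_eq_bot']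
    intro P hP
    by_contra hne
    have h0 : ‖T₂ P.1‖ₑ = 0 := by
      rw [enorm_eq_zero]
      exact hP
    rw [e₂] at h0
    exact weightedLpNorm_ne_zero (fun h => hne (Subtype.ext h)) hp0 lam h0
  obtain ⟨P, hP0, hP⟩ := exists_forall_norm_mul_le (T₁ ∘ₗ B.subtype) (T₂ ∘ₗ B.subtype) hinj
  have hP0' : P.1 ≠ 0 := fun h => hP0 (Subtype.ext h)
  refine ⟨P.1, P.2, hP0', le_antisymm ?_ ?_⟩
  · refine iSup₂_le fun h hh => ?_
    have key := ENNReal.ofReal_le_ofReal (hP ⟨h, hh.1⟩)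
    rw [ENNReal.ofReal_mul (norm_nonneg _), ENNReal.ofReal_mul (norm_nonneg _)] at key
    simp only [ofReal_norm, LinearMap.comp_apply, Submodule.subtype_apply, e₁, e₂] at key
    rw [ENNReal.div_le_iff (weightedLpNorm_ne_zero hh.2 hp0 lam)
      (weightedLpNorm_ne_top h p hlam), ← ENNReal.mul_div_right_comm,
      ENNReal.le_div_iff_mul_le (Or.inl (weightedLpNorm_ne_zero hP0' hp0 lam))
      (Or.inl (weightedLpNorm_ne_top _ p hlam))]
    exact key
  · exact le_iSup₂ (f := fun h (_ : h ∈ {h : MvPolynomial (Fin m) ℂ | h ∈ B ∧ h ≠ 0}) =>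
      supNorm (cube m) (polyFun h) / weightedLpNorm p (gegenbauerWeight lam) (cube m) (polyFun h))
      P.1 ⟨P.2, hP0'⟩

/-! ### Moving the maximum point -/

/-- One coordinate of the point where an extremal polynomial attains its maximum modulus can be
moved to `±1` by passing to a generalized translate. -/
lemma IsExtremalPolynomial.exists_update {m : ℕ} {S : Set (Fin m →₀ ℕ)} (hS : IsLowerSet S)
    {p : ℝ} (hp : 1 ≤ p) {lam : Fin m → ℝ} (hlam : ∀ j, 0 ≤ lam j) {P : MvPolynomial (Fin m) ℂ}
    (hP : IsExtremalPolynomial (MvPolynomial.restrictSupport ℂ S) p (gegenbauerWeight lam)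
      (cube m) P) {x : Fin m → ℝ} (hx : x ∈ cube m)
    (hPx : supNorm (cube m) (polyFun P) = ‖polyFun P x‖ₑ) (j : Fin m) {ε : ℝ} (hε : |ε| = 1) :
    ∃ Q, IsExtremalPolynomial (MvPolynomial.restrictSupport ℂ S) p (gegenbauerWeight lam)
      (cube m) Q ∧
      supNorm (cube m) (polyFun Q) = ‖polyFun Q (Function.update x j ε)‖ₑ := by
  have hp0 : 0 < p := by linarith
  obtain ⟨hPS, hP0, hPN⟩ := hP
  obtain ⟨ρ, hρ⟩ := exists_isTranslationMeasure (hlam j)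
  have := hρ.isProbabilityMeasure
  have hε2 : ε ^ 2 = 1 := by rw [← sq_abs, hε, one_pow]
  have hs : (x j * ε) ^ 2 + √(1 - (x j * ε) ^ 2) ^ 2 = 1 := by
    rw [Real.sq_sqrt, add_sub_cancel]
    rw [mul_pow, hε2, mul_one, sub_nonneg, sq_le_one_iff_abs_le_one]
    exact hx j
  -- With `s = x_j ε`, at `x_j = ε` the argument is `x_j ε² = x_j` for every `u`, so the average
  -- reproduces the value `P(x)`.
  obtain ⟨Q, hQS, hQ⟩ := exists_polyFun_eq_integral hS hρ j (x j * ε) _ hPS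
  have hle := weightedLpNorm_translate_le hp lam j hρ hs hQ
  set y := Function.update x j ε with hy
  have hyc : y ∈ cube m := by
    intro i
    rcases eq_or_ne i j with rfl | hi
    · simp [hy, hε]
    · simpa [hy, Function.update_of_ne hi] using hx i
  have hQy : polyFun Q y = polyFun P x := by
    rw [hQ y (abs_le.1 (hyc j))]
    have h2 : x j * ε * ε = x j := by rw [mul_assoc, ← sq, hε2, mul_one]
    simp [hε2, h2, hy]
  have hge : supNorm (cube m) (polyFun P) ≤ supNorm (cube m) (polyFun Q) := by
    rw [hPx, ← hQy]
    exact enorm_le_supNorm Q hyc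
  have hQ0 : Q ≠ 0 := by
    rintro rfl
    apply supNorm_ne_zero hP0
    rw [hPx, ← hQy]
    simp [polyFun]
  have hQN : supNorm (cube m) (polyFun Q) /
      weightedLpNorm p (gegenbauerWeight lam) (cube m) (polyFun Q) ≤
      sharpConst (MvPolynomial.restrictSupport ℂ S) p (gegenbauerWeight lam) (cube m) :=
    le_iSup₂ (f := fun h (_ : h ∈ {h : MvPolynomial (Fin m) ℂ |
        h ∈ MvPolynomial.restrictSupport ℂ S ∧ h ≠ 0}) =>
      supNorm (cube m) (polyFun h) / weightedLpNorm p (gegenbauerWeight lam) (cube m) (polyFun h))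
      Q ⟨hQS, hQ0⟩
  have hQn0 := weightedLpNorm_ne_zero hQ0 hp0 lam
  have hQnt := weightedLpNorm_ne_top Q p hlam
  have hPQ : sharpConst (MvPolynomial.restrictSupport ℂ S) p (gegenbauerWeight lam) (cube m) ≤
      supNorm (cube m) (polyFun P) /
        weightedLpNorm p (gegenbauerWeight lam) (cube m) (polyFun Q) :=
    hPN.le.trans (ENNReal.div_le_div_left hle _)
  refine ⟨Q, ⟨hQS, hQ0, le_antisymm (hPQ.trans (ENNReal.div_le_div_right hge _)) hQN⟩, ?_⟩
  rw [hQy, ← hPx]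
  refine le_antisymm ?_ hge
  -- Extremality squeezes the sup norms: both ratios now have the norm of `Q` as denominator, which
  -- is finite and nonzero and cancels.
  have := hQN.trans hPQ
  rwa [ENNReal.div_le_iff hQn0 hQnt, ENNReal.div_mul_cancel hQn0 hQnt] at this

/-! ### Exponent sets of convex bodies -/

section Bodies

variable {m : ℕ} {V : Set (Fin m → ℝ)}

lemma IsSymmConvexBody.zero_mem (hV : IsSymmConvexBody V) : (0 : Fin m → ℝ) ∈ V := by
  obtain ⟨t, ht⟩ := hV.interior_nonempty
  have htV := interior_subset ht
  have := hV.convex htV (hV.neg_mem t htV) (a := 1 / 2) (b := 1 / 2) (by norm_num) (by norm_num)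
    (by norm_num)
  simpa using this

lemma isLowerSet_exponents (hV : IsSymmConvexBody V) (hVPi : PiCondition V) {a : ℝ}
    (ha : 0 ≤ a) : IsLowerSet {k : Fin m →₀ ℕ | (fun j => (k j : ℝ)) ∈ a • V} := by
  rintro k l hlk ⟨t, htV, htk⟩
  have htk' : ∀ j, a * t j = k j := fun j => congrFun htk j
  have hlk' : ∀ j, (l j : ℝ) ≤ k j := fun j => Nat.cast_le.2 (hlk j)
  have hl0 : ∀ j, (k j : ℝ) = 0 → (l j : ℝ) = 0 := fun j h =>
    le_antisymm (h ▸ hlk' j) (Nat.cast_nonneg _)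
  -- The Π-condition says nothing at `t = 0`, and `a = 0` cannot be inverted; in both cases `k = 0`,
  -- which forces `l = 0`.
  by_cases h0 : a = 0 ∨ t = 0
  · refine ⟨0, hV.zero_mem, funext fun j => ?_⟩
    have : (l j : ℝ) = 0 := hl0 j (by rw [← htk' j]; rcases h0 with h | h <;> simp [h])
    simp [this]
  · push Not at h0
    have ha' : 0 < a := lt_of_le_of_ne ha (Ne.symm h0.1)
    refine ⟨fun j => a⁻¹ * l j, hVPi t htV h0.2 fun j => ?_, funext fun j => ?_⟩
    · have ht : t j = a⁻¹ * k j := by rw [← htk' j]; field_simp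
      rw [ht, abs_of_nonneg (by positivity), abs_of_nonneg (by positivity)]
      gcongr
      exact hlk j
    · simp [h0.1]

lemma finite_exponents (hV : IsSymmConvexBody V) (a : ℝ) :
    {k : Fin m →₀ ℕ | (fun j => (k j : ℝ)) ∈ a • V}.Finite := by
  obtain ⟨C, hC⟩ := (hV.isCompact.smul a).isBounded.exists_norm_le
  refine (Set.finite_Icc (0 : Fin m →₀ ℕ) (Finsupp.equivFunOnFinite.symm fun _ => ⌊C⌋₊)).subset ?_
  intro k hk
  refine ⟨zero_le, fun j => ?_⟩
  change k j ≤ ⌊C⌋₊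
  refine Nat.le_floor ?_
  have := (norm_le_pi_norm (fun j => (k j : ℝ)) j).trans (hC _ hk)
  simpa using this

end Bodies

end CubeNikolskii

theorem lemmaL2p7 {m : ℕ} (hm : 1 ≤ m) (V : Set (Fin m → ℝ))
    (hV : CubeNikolskii.IsSymmConvexBody V) (hVPi : CubeNikolskii.PiCondition V)
    (a : ℝ) (ha : 0 ≤ a) (p : ℝ) (hp : 1 ≤ p)
    (lam : Fin m → ℝ) (hlam : ∀ j, 0 ≤ lam j)
    (x₀ : Fin m → ℝ) (hx₀ : x₀ ∈ CubeNikolskii.cubeVertices m) :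
    ∃ P : MvPolynomial (Fin m) ℂ,
      CubeNikolskii.IsExtremalPolynomial (CubeNikolskii.polyClass (a • V)) p
        (CubeNikolskii.gegenbauerWeight lam) (CubeNikolskii.cube m) P ∧
      CubeNikolskii.supNorm (CubeNikolskii.cube m) (CubeNikolskii.polyFun P) =
        ‖CubeNikolskii.polyFun P x₀‖ₑ := by
  open CubeNikolskii in
  set S := {k : Fin m →₀ ℕ | (fun j => (k j : ℝ)) ∈ a • V} with hSdef
  have hS : IsLowerSet S := isLowerSet_exponents hV hVPi ha
  have hSfin : Finite S := (finite_exponents hV a).to_subtype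
  have h0S : (0 : Fin m →₀ ℕ) ∈ S := ⟨0, hV.zero_mem, by ext; simp⟩
  have hB : polyClass (a • V) = MvPolynomial.restrictSupport ℂ S := rfl
  rw [hB]
  have hfd : FiniteDimensional ℂ (MvPolynomial.restrictSupport ℂ S) :=
    Module.Finite.of_basis (MvPolynomial.basisRestrictSupport ℂ S)
  have hnt : Nontrivial (MvPolynomial.restrictSupport ℂ S) :=
    ⟨⟨⟨MvPolynomial.monomial 0 1, (MvPolynomial.monomial_mem_restrictSupport ℂ).2 (Or.inl h0S)⟩, 0,
      fun h => by simpa using congrArg Subtype.val h⟩⟩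
  obtain ⟨P₁, hP₁⟩ := exists_isExtremalPolynomial (MvPolynomial.restrictSupport ℂ S) hp hlam
  -- Induction on the set of coordinates already matched to `x₀`; each translation alters one
  -- coordinate of the maximum point and keeps the rest.
  have key : ∀ s : Finset (Fin m), ∃ P, ∃ x ∈ cube m,
      IsExtremalPolynomial (MvPolynomial.restrictSupport ℂ S) p (gegenbauerWeight lam) (cube m) P ∧
      supNorm (cube m) (polyFun P) = ‖polyFun P x‖ₑ ∧ ∀ i ∈ s, x i = x₀ i := by
    intro s
    induction s using Finset.induction_on with
    | empty =>
      obtain ⟨x, hx, hPx⟩ := exists_supNorm_eq P₁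
      exact ⟨P₁, x, hx, hP₁, hPx, by simp⟩
    | insert j s _ ih =>
      obtain ⟨P, x, hx, hP, hPx, hxs⟩ := ih
      obtain ⟨Q, hQ, hQx⟩ := hP.exists_update hS hp hlam hx hPx j (hx₀ j)
      refine ⟨Q, Function.update x j (x₀ j), fun i => ?_, hQ, hQx, fun i hi => ?_⟩
      · rcases eq_or_ne i j with rfl | hij
        · simpa using (hx₀ i).le
        · simpa [Function.update_of_ne hij] using hx i
      · rcases eq_or_ne i j with rfl | hij
        · simp
        · rw [Function.update_of_ne hij]
          exact hxs i (Finset.mem_of_mem_insert_of_ne hi hij)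
  obtain ⟨P, x, _, hP, hPx, hx⟩ := key Finset.univ
  obtain rfl : x = x₀ := funext fun i => hx i (Finset.mem_univ i)
  exact ⟨P, hP, hPx⟩
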